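/- A free ultrafilter $r$ on $\omega$ is \emph{Ramsey} if for every partition $\{P_n:n\in\omega\}$ of $\omega$ into nonempty sets, either $P_i\in r$ for some $i$, or there is $U\in r$ with $|U\cap P_i|=1$ for every $i\in\omega$. For a free ultrafilter $p$ on $\omega$ and a topological space $X$, a point $x$ is the \emph{$p$-limit} of a sequence $(x_n)_{n\in D}$ in $X$, where $D\subseteq\omega$, if $\{n\in D:x_n\in U\}\in p$ for every open $U\ni x$; it is the \emph{$p^2$-limit} of $f:[\omega]^2\to X$ if $\{n:\{m>n:f(\{n,m\})\in U\}\in p\}\in p$ for every open $U\ni x$; and it is the \emph{double $p$-limit} of $f$ if there are $A\in p$ and points $x_n\in X$ $(n\in A)$ such that $x_n$ is the $p$-limit of $(f(\{n,m\}))_{m>n}$ for every $n\in A$, and $x$ is the $p$-limit of $(x_n)_{n\in A}$. The space $X$ is \emph{2-countably compact} (respectively \emph{doubly countably compact}) if every $f:[\omega]^2\to X$ has a $p^2$-limit (respectively a double $p$-limit) in $X$ for some free ultrafilter $p$ on $\omega$. \textbf{Theorem.} Assume that a Ramsey ultrafilter exists. Then there is a Tychonoff space which is 2-countably compact but not doubly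 countably compact. More precisely, there are doubly countably compact subspaces $A_n$ $(n\in\omega)$ of $\beta\omega$ with $A_n\cap A_m=\omega$ whenever $n\neq m$ (where $\omega$ is identified with the set of principal ultrafilters) such that the following holds. Let $C_n\subseteq\beta(\omega\times\omega)$ be the image of $A_n$ under the continuous extension $\beta\omega\to\beta(\omega\times\omega)$ of $m\mapsto(n,m)$, and let $C_\omega$ be the set of all $q\in\beta(\omega\times\omega)$ such that $\{k\}\times\omega\notin q$ for every $k\in\omega$. Then the subspace $X=C_\omega\cup\bigcup_{n\in\omega}C_n$ of $\beta(\omega\times\omega)$ is Tychonoff and 2-countably compact, but not doubly countably compact. -/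

import Mathlib

/-! `βω` is `Ultrafilter ℕ` and `β(ω × ω)` is `Ultrafilter (ℕ × ℕ)`, with Mathlib's topology. -/

/-- A free (non-principal) ultrafilter on `ω`, that is, an element of `ω*`: it contains every
cofinite set. -/
def IsFree (p : Ultrafilter ℕ) : Prop :=
  ∀ s : Set ℕ, sᶜ.Finite → s ∈ p

/-- A free ultrafilter `p` is Ramsey if for every partition `(P n)` of `ω` into nonempty sets,
either some `P i` is in `p`, or some `U ∈ p` meets every `P i` in exactly one point. -/
def IsRamsey (p : Ultrafilter ℕ) : Prop :=
  IsFree p ∧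
    ∀ P : ℕ → Set ℕ, (∀ i, (P i).Nonempty) → (∀ i j, i ≠ j → Disjoint (P i) (P j)) →
      (⋃ i, P i) = Set.univ →
      (∃ i, P i ∈ p) ∨ ∃ U ∈ p, ∀ i, ∃! x, x ∈ U ∩ P i

/-- `[ω]²`, a two-element set being identified with its increasing enumeration `(n, m)`, `n < m`.
A double sequence `{x_{n,m} : n < m < ω}` in `X` is a function `Pairs → X`. -/
abbrev Pairs : Type := {q : ℕ × ℕ // q.1 < q.2}

/-- Membership of a set `A ⊆ [ω]²` in the ultrafilter `p²` (for `p` free): for `p`-almost all `n`,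
for `p`-almost all `m > n`, the pair `{n, m}` is in `A`. -/
def MemSq (p : Ultrafilter ℕ) (A : Set Pairs) : Prop :=
  {n : ℕ | {m : ℕ | ∃ h : n < m, (⟨(n, m), h⟩ : Pairs) ∈ A} ∈ p} ∈ p

/-- `x` is the `p²`-limit of `f : [ω]² → X`. -/
def IsSqLimit {X : Type*} [TopologicalSpace X] (p : Ultrafilter ℕ) (f : Pairs → X) (x : X) :
    Prop :=
  ∀ U : Set X, IsOpen U → x ∈ U → MemSq p (f ⁻¹' U)

/-- `x` is the `p`-limit of the sequence `{s n : n ∈ D}` indexed by a set `D ⊆ ω`. -/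
def IsPLimit {X : Type*} [TopologicalSpace X] (p : Ultrafilter ℕ) (D : Set ℕ) (s : D → X)
    (x : X) : Prop :=
  ∀ U : Set X, IsOpen U → x ∈ U → {n : ℕ | ∃ h : n ∈ D, s ⟨n, h⟩ ∈ U} ∈ p

/-- `x` is the double `p`-limit of `{f (n, m) : n < m < ω}`: for some `A ∈ p` there are points
`y n`, `n ∈ A`, of `X` such that `y n` is the `p`-limit of `{f (n, m) : m > n}` for each `n ∈ A`
and `x` is the `p`-limit of `{y n : n ∈ A}`. -/
def IsDoubleLimit {X : Type*} [TopologicalSpace X] (p : Ultrafilter ℕ) (f : Pairs → X) (x : X) :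
    Prop :=
  ∃ A ∈ p, ∃ y : A → X,
    (∀ n : A, IsPLimit p (Set.Ioi (n : ℕ)) (fun m => f ⟨((n : ℕ), (m : ℕ)), m.2⟩) (y n)) ∧
      IsPLimit p A y x

/-- Every `f : [ω]² → X` has a `p²`-limit for some free ultrafilter `p`. -/
def TwoCountablyCompact (X : Type*) [TopologicalSpace X] : Prop :=
  ∀ f : Pairs → X, ∃ p : Ultrafilter ℕ, IsFree p ∧ ∃ x : X, IsSqLimit p f x

/-- Every double sequence in `X` has a double `p`-limit for some free ultrafilter `p`. -/
def DoublyCountablyCompact (X : Type*) [TopologicalSpace X] : Prop :=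
  ∀ f : Pairs → X, ∃ p : Ultrafilter ℕ, IsFree p ∧ ∃ x : X, IsDoubleLimit p f x

/-- The column `{n} × ω`. -/
def column (n : ℕ) : Set (ℕ × ℕ) := {n} ×ˢ Set.univ

/-- The copy in the closure of the `n`-th column of a subset `A` of `βω`: its image under the
extension `βω → β(ω × ω)` of `m ↦ (n, m)`. -/
def columnCopy (n : ℕ) (A : Set (Ultrafilter ℕ)) : Set (Ultrafilter (ℕ × ℕ)) :=
  Ultrafilter.map (Prod.mk n) '' A

/-- The subspace of `β(ω × ω)` made of the copies of the `A n` in the closures of the columns and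
of all ultrafilters that contain no column. -/
def columnSpace (A : ℕ → Set (Ultrafilter ℕ)) : Set (Ultrafilter (ℕ × ℕ)) :=
  (⋃ n, columnCopy n (A n)) ∪ {q | ∀ k, column k ∉ q}

/-! For 2-countable compactness, take the `q²`-limit in `β(ω × ω)` of a double sequence in `X`. If
it contains no column, it is already in `X`. Otherwise Ramsey's theorem gives an infinite set on
whose pairs all values lie over one column `k`, and double countable compactness of `A k` finishes.
On the other hand, a double `p`-limit of the principal points `(n, m)` would put `p` in `A n` for
`p`-almost all `n`. Two such `n` make `p` principal, which is impossible.

The work is in the `A n`. Each is generated from `ω` by adding limits of double sequences, in a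
recursion over pairs (index, countably branching tree), so there are at most continuum many steps.
Each step must avoid all earlier points, except those in the range of the given sequence
(`exists_isLimitSeq`). A nonprincipal point common to `A n` and `A m` would then have a first
occurrence in each, and the later of the two would contradict the avoidance.

Avoidance is a counting argument. After restriction to an infinite `H`, the sequence is constant or
separated by disjoint sets (`exists_infinite_const_or_separatedOn`). Hence each row limit or double
limit outside the range determines `p`. If every free `p` containing `H` had a limit in the
forbidden set, `βω` would have at most continuum many points, contrary to
`continuum_lt_mk_ultrafilter`. -/

theorem IsFree.eventually_gt {p : Ultrafilter ℕ} (hp : IsFree p) (n : ℕ) :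
    ∀ᶠ m in (p : Filter ℕ), n < m :=
  hp {m | n < m} ((Set.finite_Iic n).subset fun m hm => by simpa using hm)

/-! ### Ramsey-type fusion along a free ultrafilter -/

/-- Fusion along an ultrafilter: a property of finite sets that holds of `∅` and is preserved by
inserting almost every point holds of all finite subsets of some infinite set. -/
theorem exists_infinite_forall_finset {q : Ultrafilter ℕ} (hq : IsFree q) (S : Finset ℕ → Prop)
    (h0 : S ∅) (hS : ∀ t, S t → ∀ᶠ m in (q : Filter ℕ), S (insert m t)) :
    ∃ H : Set ℕ, H.Infinite ∧ ∀ t : Finset ℕ, (t : Set ℕ) ⊆ H → S t := by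
  classical
  -- The hereditary form of `S` is what a recursion adding one point at a time can preserve.
  let G : Finset ℕ → Prop := fun s => ∀ t ⊆ s, S t
  have hG0 : G ∅ := by
    intro t ht
    rwa [Finset.subset_empty.1 ht]
  have hstep : ∀ s : {s // G s}, ∃ m, m ∉ s.1 ∧ G (insert m s.1) := by
    rintro ⟨s, hs⟩
    have h1 : ∀ᶠ m in (q : Filter ℕ), ∀ t ∈ s.powerset, S (insert m t) :=
      (Filter.eventually_all_finset _).2 fun t ht => hS t (hs t (Finset.mem_powerset.1 ht))
    have h2 : ∀ᶠ m in (q : Filter ℕ), m ∉ s :=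
      hq {m | m ∉ s} (s.finite_toSet.subset fun m hm => by simpa using hm)
    obtain ⟨m, h1, h2⟩ := (h1.and h2).exists
    refine ⟨m, h2, fun t ht => ?_⟩
    by_cases hm : m ∈ t
    · rw [← Finset.insert_erase hm]
      exact h1 _ (Finset.mem_powerset.2 (Finset.subset_insert_iff.1 ht))
    · exact hs t ((Finset.subset_insert_iff_of_notMem hm).1 ht)
  choose m hm hGm using hstep
  let s : ℕ → {s // G s} := fun n => Nat.rec ⟨∅, hG0⟩ (fun _ s => ⟨insert (m s) s.1, hGm s⟩) n
  have hs : ∀ n, (s (n + 1)).1 = insert (m (s n)) (s n).1 := fun n => rfl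
  have hmono : Monotone fun n => (s n).1 :=
    monotone_nat_of_le_succ fun n => by rw [hs]; exact Finset.subset_insert _ _
  have hcard : ∀ n, (s n).1.card = n := by
    intro n
    induction n with
    | zero => rfl
    | succ n ih => rw [hs, Finset.card_insert_of_notMem (hm _), ih]
  refine ⟨⋃ n, ((s n).1 : Set ℕ), fun hfin => ?_, fun t ht => ?_⟩
  · have h := Set.ncard_le_ncard (Set.subset_iUnion (fun n => ((s n).1 : Set ℕ))
      ((⋃ n, ((s n).1 : Set ℕ)).ncard + 1)) hfin
    have h' := hcard ((⋃ n, ((s n).1 : Set ℕ)).ncard + 1)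
    rw [Set.ncard_coe_finset] at h
    omega
  · choose k hk using fun x : t => Set.mem_iUnion.1 (ht x.2)
    obtain ⟨n, hn⟩ := (Set.finite_range k).bddAbove
    exact (s n).2 t fun x hx => hmono (hn ⟨⟨x, hx⟩, rfl⟩) (hk ⟨x, hx⟩)

/-- Ramsey's theorem along an ultrafilter. -/
theorem exists_infinite_forall_lt {q : Ultrafilter ℕ} (hq : IsFree q) {R : ℕ → ℕ → Prop}
    (hR : ∀ᶠ n in (q : Filter ℕ), ∀ᶠ m in (q : Filter ℕ), R n m) :
    ∃ H : Set ℕ, H.Infinite ∧ ∀ i ∈ H, ∀ j ∈ H, i < j → R i j := by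
  obtain ⟨H, hH, h⟩ := exists_infinite_forall_finset hq
    (fun t => (∀ i ∈ t, ∀ᶠ m in (q : Filter ℕ), R i m) ∧ ∀ i ∈ t, ∀ j ∈ t, i < j → R i j)
    (by simp) (by
      rintro t ⟨h1, h2⟩
      filter_upwards [hR, (Filter.eventually_all_finset t).2 h1,
        (Filter.eventually_all_finset t).2 fun i _ => hq.eventually_gt i] with m e1 e2 e3
      refine ⟨fun i hi => ?_, fun i hi j hj hij => ?_⟩
      · rcases Finset.mem_insert.1 hi with rfl | hi
        exacts [e1, h1 i hi]
      · rcases Finset.mem_insert.1 hj with rfl | hj'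
        · exact e2 i ((Finset.mem_insert.1 hi).resolve_left hij.ne)
        · rcases Finset.mem_insert.1 hi with rfl | hi
          exacts [absurd hij (e3 j hj').not_gt, h2 i hi j hj' hij])
  exact ⟨H, hH, fun i hi j hj hij =>
    (h {i, j} (by simp [Set.insert_subset_iff, hi, hj])).2 i (by simp) j (by simp) hij⟩

/-! ### Cardinality of `βω` -/

open Cardinal in
/-- `βω` has more than `2 ^ ℵ₀` points. -/
theorem continuum_lt_mk_ultrafilter : 𝔠 < #(Ultrafilter ℕ) := by
  classical
  let tr : Set ℕ → Finset ℕ → Finset ℕ := fun X F => F.filter (· ∈ X)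
  -- The classical independent family of continuum many subsets of a countable set, indexed by `X ⊆
  -- ω`.
  let I : Set ℕ → Set (Finset ℕ × Finset (Finset ℕ)) := fun X => {a | tr X a.1 ∈ a.2}
  have key : ∀ T : Set (Set ℕ), ∃ u : Ultrafilter (Finset ℕ × Finset (Finset ℕ)),
      ∀ X, I X ∈ u ↔ X ∈ T := by
    intro T
    let G : Set ℕ → Set (Finset ℕ × Finset (Finset ℕ)) := fun X => {a | a ∈ I X ↔ X ∈ T}
    have hne : (Filter.generate (Set.range G)).NeBot := by
      rw [Filter.generate_neBot_iff]
      intro t ht htf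
      obtain ⟨D, hDf, rfl⟩ : ∃ D : Set (Set ℕ), D.Finite ∧ G '' D = t := by
        choose g hg using fun a : t => ht a.2
        have := htf.to_subtype
        refine ⟨Set.range g, Set.finite_range g, Set.ext fun a => ⟨?_, fun ha => ?_⟩⟩
        · rintro ⟨_, ⟨b, rfl⟩, rfl⟩
          exact hg b ▸ b.2
        · exact ⟨_, ⟨⟨a, ha⟩, rfl⟩, hg ⟨a, ha⟩⟩
      have hsep : ∀ X Y : Set ℕ, ∃ n, X ≠ Y → ¬ (n ∈ X ↔ n ∈ Y) := by
        intro X Y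
        by_contra! h
        exact (h 0).1 (Set.ext fun n => (h n).2)
      choose d hd using hsep
      let F : Finset ℕ := (hDf.toFinset ×ˢ hDf.toFinset).image fun a => d a.1 a.2
      -- `F` separates the members of `D`, so distinct members have distinct traces on it; the
      -- second coordinate collects the traces of those in `T`.
      refine ⟨(F, (hDf.toFinset.filter (· ∈ T)).image fun X => tr X F), ?_⟩
      rintro _ ⟨X, hX, rfl⟩
      constructor
      · intro h
        obtain ⟨Y, hY, hYX⟩ := Finset.mem_image.1 h
        obtain ⟨hYD, hYT⟩ := Finset.mem_filter.1 hY
        by_contra hXT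
        have hYX' : Y ≠ X := fun h => hXT (h ▸ hYT)
        refine hd Y X hYX' ?_
        have hF : d Y X ∈ F := Finset.mem_image.2
          ⟨(Y, X), Finset.mem_product.2 ⟨hYD, hDf.mem_toFinset.2 hX⟩, rfl⟩
        have := congrArg (d Y X ∈ ·) hYX
        simpa [tr, hF] using this
      · intro h
        exact Finset.mem_image.2 ⟨X, Finset.mem_filter.2 ⟨hDf.mem_toFinset.2 hX, h⟩, rfl⟩
    refine ⟨Ultrafilter.of (Filter.generate (Set.range G)), fun X => ?_⟩
    have hG : G X ∈ Ultrafilter.of (Filter.generate (Set.range G)) :=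
      Ultrafilter.of_le _ (Filter.mem_generate_of_mem ⟨X, rfl⟩)
    constructor
    · intro h
      obtain ⟨a, ha, hb⟩ := Ultrafilter.nonempty_of_mem (Filter.inter_mem hG h)
      exact ha.1 hb
    · intro h
      filter_upwards [hG] with a ha using ha.2 h
  choose u hu using key
  have hinj : Function.Injective u := fun T T' h => Set.ext fun X => by rw [← hu T, h, hu T']
  obtain ⟨e, he⟩ := exists_injective_nat (Finset ℕ × Finset (Finset ℕ))
  have hmap : Function.Injective (Ultrafilter.map e) := fun v w h =>
    Ultrafilter.coe_injective (Filter.map_injective he (congrArg Ultrafilter.toFilter h))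
  calc 𝔠 < 2 ^ 𝔠 := cantor _
    _ = #(Set (Set ℕ)) := by simp
    _ ≤ #(Ultrafilter ℕ) := mk_le_of_injective (hmap.comp hinj)

/-! ### Limits of separated sequences -/

/-- `p.bind s` is the `p`-limit of the sequence `s`. -/
theorem mem_bind_iff_eventually {α : Type*} {p : Ultrafilter ℕ} {s : ℕ → Ultrafilter α}
    {U : Set α} :
    U ∈ p.bind s ↔ ∀ᶠ n in (p : Filter ℕ), U ∈ s n :=
  Iff.rfl

theorem Ultrafilter.exists_mem_notMem {α : Type*} {p p' : Ultrafilter α} (h : p ≠ p') :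
    ∃ E ∈ p, E ∉ p' := by
  by_contra! hE
  exact h (Ultrafilter.eq_of_le hE).symm

/-- A sequence of ultrafilters converging along `q` to a point different from `z` avoids `z`. -/
theorem eventually_ne_of_bind_ne {q z : Ultrafilter ℕ} {s : ℕ → Ultrafilter ℕ}
    (h : q.bind s ≠ z) : ∀ᶠ m in (q : Filter ℕ), s m ≠ z := by
  obtain ⟨E, hE, hE'⟩ := Ultrafilter.exists_mem_notMem h
  filter_upwards [mem_bind_iff_eventually.1 hE] with m hm hmz
  exact hE' (hmz ▸ hm)

/-- A sequence of ultrafilters whose limit does not contain `W` eventually does not contain `W`. -/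
theorem eventually_notMem_of_notMem_bind {q : Ultrafilter ℕ} {s : ℕ → Ultrafilter ℕ} {W : Set ℕ}
    (h : W ∉ q.bind s) : ∀ᶠ m in (q : Filter ℕ), W ∉ s m :=
  Ultrafilter.eventually_not.2 h

/-- An ultrafilter contains a set lying in none of finitely many other ultrafilters. -/
theorem exists_mem_forall_notMem {ι : Type*} (t : Finset ι) (a : Ultrafilter ℕ)
    (b : ι → Ultrafilter ℕ) : ∃ W ∈ a, ∀ k ∈ t, a ≠ b k → W ∉ b k := by
  have h : ∀ k, ∃ W ∈ a, a ≠ b k → W ∉ b k := fun k => by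
    by_cases hk : a = b k
    · exact ⟨Set.univ, Filter.univ_mem, fun h => absurd hk h⟩
    · obtain ⟨W, hW, hW'⟩ := Ultrafilter.exists_mem_notMem hk
      exact ⟨W, hW, fun _ => hW'⟩
  choose W hW hWb using h
  exact ⟨⋂ k ∈ t, W k, (Filter.biInter_finset_mem t).2 fun k _ => hW k, fun k hk hne hmem =>
    hWb k hne (Filter.mem_of_superset hmem (Set.biInter_subset_of_mem hk))⟩

/-- Distinct free ultrafilters containing `H` give distinct limits of a sequence separated by
disjoint sets. -/
theorem eq_of_bind_eq {s : ℕ → Ultrafilter ℕ} {W : ℕ → Set ℕ} {H : Set ℕ} {p p' : Ultrafilter ℕ}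
    (hp : H ∈ p) (hp' : H ∈ p') (hs : ∀ i ∈ H, W i ∈ s i)
    (hW : ∀ i ∈ H, ∀ j ∈ H, i ≠ j → Disjoint (W i) (W j)) (h : p.bind s = p'.bind s) : p = p' := by
  by_contra hne
  obtain ⟨E, hE, hE'⟩ := Ultrafilter.exists_mem_notMem hne
  have h1 : (⋃ i ∈ E ∩ H, W i) ∈ p'.bind s := by
    rw [← h, mem_bind_iff_eventually]
    filter_upwards [hE, hp] with i hi hiH
    exact Filter.mem_of_superset (hs i hiH) (Set.subset_biUnion_of_mem (u := W) ⟨hi, hiH⟩)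
  obtain ⟨j, hj, hjH, hjE⟩ := ((mem_bind_iff_eventually.1 h1).and
    (Filter.Eventually.and hp' (Ultrafilter.compl_mem_iff_notMem.2 hE'))).exists
  obtain ⟨x, hx, hxj⟩ := Ultrafilter.nonempty_of_mem (Filter.inter_mem hj (hs j hjH))
  obtain ⟨i, hi, hxi⟩ := Set.mem_iUnion₂.1 hx
  exact Set.disjoint_left.1 (hW i hi.2 j hjH fun h => hjE (h ▸ hi.1)) hxi hxj

/-- Distinct free ultrafilters containing `H` give distinct double limits, if the values at
disjoint pairs from `H` are separated by disjoint sets. -/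
theorem eq_of_bind_bind_eq {F : ℕ → ℕ → Ultrafilter ℕ} {W : ℕ → ℕ → Set ℕ} {H : Set ℕ}
    {p p' : Ultrafilter ℕ} (hpf : IsFree p) (hpf' : IsFree p') (hp : H ∈ p) (hp' : H ∈ p')
    (hs : ∀ i ∈ H, ∀ j ∈ H, i < j → W i j ∈ F i j)
    (hW : ∀ i ∈ H, ∀ j ∈ H, ∀ k ∈ H, ∀ l ∈ H, i < j → k < l → i ≠ k → i ≠ l → j ≠ k → j ≠ l →
      Disjoint (W i j) (W k l))
    (h : (p.bind fun n => p.bind (F n)) = p'.bind fun n => p'.bind (F n)) : p = p' := by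
  by_contra hne
  obtain ⟨E, hE, hE'⟩ := Ultrafilter.exists_mem_notMem hne
  have h1 : (⋃ i ∈ E ∩ H, ⋃ j ∈ E ∩ H ∩ Set.Ioi i, W i j) ∈
      p'.bind fun n => p'.bind (F n) := by
    rw [← h, mem_bind_iff_eventually]
    filter_upwards [hE, hp] with i hi hiH
    rw [mem_bind_iff_eventually]
    filter_upwards [hE, hp, hpf.eventually_gt i] with j hj hjH hij
    refine Filter.mem_of_superset (hs i hiH j hjH hij) fun x hx => ?_
    exact Set.mem_iUnion₂.2 ⟨i, ⟨hi, hiH⟩, Set.mem_iUnion₂.2 ⟨j, ⟨⟨hj, hjH⟩, hij⟩, hx⟩⟩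
  -- The pair `(k, l)` is taken outside `E`, while `(i, j)` comes from `E`. So disjointness of `W`
  -- is needed only for pairs without a common point.
  have hEH := Filter.Eventually.and hp' (Ultrafilter.compl_mem_iff_notMem.2 hE')
  obtain ⟨k, hk, hkH, hkE⟩ := ((mem_bind_iff_eventually.1 h1).and hEH).exists
  obtain ⟨l, ⟨hl, hkl⟩, hlH, hlE⟩ :=
    (((mem_bind_iff_eventually.1 hk).and (hpf'.eventually_gt k)).and hEH).exists
  obtain ⟨x, hx, hxl⟩ := Ultrafilter.nonempty_of_mem (Filter.inter_mem hl (hs k hkH l hlH hkl))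
  obtain ⟨i, hi, hx⟩ := Set.mem_iUnion₂.1 hx
  obtain ⟨j, hj, hx⟩ := Set.mem_iUnion₂.1 hx
  refine Set.disjoint_left.1 (hW i hi.2 j hj.1.2 k hkH l hlH hj.2 hkl ?_ ?_ ?_ ?_) hx hxl
  · exact fun h => hkE (h ▸ hi.1)
  · exact fun h => hlE (h ▸ hi.1)
  · exact fun h => hkE (h ▸ hj.1.1)
  · exact fun h => hlE (h ▸ hj.1.1)

/-! ### Separating a double sequence on an infinite set -/

/-- The values of `F` at the pairs from `H` are separated, except that rows may be constant. -/
structure SeparatedOn (F : ℕ → ℕ → Ultrafilter ℕ) (H : Set ℕ) (W : ℕ → ℕ → Set ℕ) : Prop where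
  mem : ∀ i ∈ H, ∀ j ∈ H, i < j → W i j ∈ F i j
  disj : ∀ i ∈ H, ∀ j ∈ H, ∀ k ∈ H, ∀ l ∈ H, i < j → k < l → i ≠ k → i ≠ l → j ≠ k → j ≠ l →
    Disjoint (W i j) (W k l)
  row : ∀ n ∈ H, (∃ z, ∀ m ∈ H, n < m → F n m = z) ∨
    ∀ j ∈ H, ∀ l ∈ H, n < j → n < l → j ≠ l → Disjoint (W n j) (W n l)

/-- The finite approximations in the construction of a set on which `F` is separated: `b n` is the
limit of the `n`-th row and `c` the limit of `b`. -/
structure Approx (q : Ultrafilter ℕ) (F : ℕ → ℕ → Ultrafilter ℕ) (b : ℕ → Ultrafilter ℕ)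
    (c : Ultrafilter ℕ) (W : ℕ → ℕ → Set ℕ) (K : ℕ → Prop) (t : Finset ℕ) : Prop where
  ne : ∀ i ∈ t, ∀ᶠ m in (q : Filter ℕ), F i m ≠ c
  row : ∀ i ∈ t, ∀ j ∈ t, i < j → K i → F i j = b i
  lim : ∀ i ∈ t, ∀ j ∈ t, i < j → (K i ∨ K j) → b i ≠ b j
  notMem_c : ∀ i ∈ t, ∀ j ∈ t, i < j → W i j ∉ c
  -- The case `k = i` with `K i` is excluded because then `F i j = b i` by `row`.
  notMem_b : ∀ i ∈ t, ∀ j ∈ t, ∀ k ∈ t, i < j → k ≠ j → (k ≠ i ∨ ¬ K i) → W i j ∉ b k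
  notMem : ∀ i ∈ t, ∀ j ∈ t, ∀ k ∈ t, ∀ l ∈ t, i < j → j < l → k < l → k ≠ j →
    (k ≠ i ∨ ¬ K i) → W i j ∉ F k l

/-- Each condition on the new point `m` holds for `q`-almost all `m`, because `F i m` tends to `b i`
and `b m` tends to `c`: whatever separates a set or a point from the limit separates it from almost
all terms. Conditions on the new sets `W i m` come from their choice. -/
theorem Approx.eventually_insert {q : Ultrafilter ℕ} (hq : IsFree q)
    {F : ℕ → ℕ → Ultrafilter ℕ} {W : ℕ → ℕ → Set ℕ} {b : ℕ → Ultrafilter ℕ} {c : Ultrafilter ℕ}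
    {K : ℕ → Prop} (hb : ∀ n, b n = q.bind (F n)) (hc : c = q.bind b)
    (hne : ∀ᶠ n in (q : Filter ℕ), ∀ᶠ m in (q : Filter ℕ), F n m ≠ c)
    (hK : ∀ n, K n ↔ ∀ᶠ m in (q : Filter ℕ), F n m = b n)
    (hWc : ∀ i j, F i j ≠ c → W i j ∉ c)
    (hWb : ∀ i j, ∀ k ≤ j, F i j ≠ b k → W i j ∉ b k) {t : Finset ℕ}
    (ht : Approx q F b c W K t) :
    ∀ᶠ m in (q : Filter ℕ), Approx q F b c W K (insert m t) := by
  have hKc : ∀ n, (∀ᶠ m in (q : Filter ℕ), F n m ≠ c) → K n → b n ≠ c := fun n h1 h2 h => by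
    obtain ⟨m, hm, hm'⟩ := (h1.and ((hK n).1 h2)).exists
    exact hm (hm'.trans h)
  have hne_b : ∀ z, z ≠ c → ∀ᶠ m in (q : Filter ℕ), b m ≠ z := fun z hz =>
    eventually_ne_of_bind_ne (hc ▸ hz.symm)
  have hne_F : ∀ n z, z ≠ b n → ∀ᶠ m in (q : Filter ℕ), F n m ≠ z := fun n z hz =>
    eventually_ne_of_bind_ne (hb n ▸ hz.symm)
  have e0 : ∀ᶠ m in (q : Filter ℕ), ∀ i ∈ t, i < m :=
    (Filter.eventually_all_finset t).2 fun i _ => hq.eventually_gt i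
  have e2 : ∀ᶠ m in (q : Filter ℕ), ∀ i ∈ t, F i m ≠ c :=
    (Filter.eventually_all_finset t).2 fun i hi => ht.ne i hi
  have e3 : ∀ᶠ m in (q : Filter ℕ), ∀ i ∈ t, K i → F i m = b i :=
    (Filter.eventually_all_finset t).2 fun i _ => by
      by_cases h : K i
      · filter_upwards [(hK i).1 h] with m hm _ using hm
      · exact Filter.Eventually.of_forall fun m h' => absurd h' h
  have e4 : ∀ᶠ m in (q : Filter ℕ), ∀ i ∈ t, (K i ∨ K m) → b i ≠ b m :=
    (Filter.eventually_all_finset t).2 fun i hi => by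
      -- If `b i = c`, then `K i` fails because row `i` avoids `c`, so `K m` holds and, by the same
      -- argument, `b m ≠ c`.
      by_cases h : b i = c
      · filter_upwards [hne] with m hm hor
        rcases hor with hor | hor
        · exact absurd h (hKc i (ht.ne i hi) hor)
        · exact h ▸ (hKc m hm hor).symm
      · filter_upwards [hne_b _ h] with m hm _ using hm.symm
  have e5 : ∀ᶠ m in (q : Filter ℕ), ∀ i ∈ t, ∀ k ∈ t, (k ≠ i ∨ ¬ K i) → F i m ≠ b k :=
    (Filter.eventually_all_finset t).2 fun i hi => (Filter.eventually_all_finset t).2 fun k hk => by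
      -- When row `i` tends to `b k` itself, either `K i` holds and `lim` forces `k = i`, or `K i`
      -- fails and row `i` avoids its own limit.
      by_cases h : b k = b i
      · by_cases hKi : K i
        · have hki : k = i := by
            by_contra hki
            rcases lt_or_gt_of_ne hki with h' | h'
            · exact ht.lim k hk i hi h' (Or.inr hKi) h
            · exact ht.lim i hi k hk h' (Or.inl hKi) h.symm
          exact Filter.Eventually.of_forall fun m hm => by simp [hki, hKi] at hm
        · filter_upwards [Ultrafilter.eventually_not.2 (mt (hK i).2 hKi)] with m hm _
          rwa [h]
      · filter_upwards [hne_F i _ h] with m hm _ using hm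
  have e6 : ∀ᶠ m in (q : Filter ℕ), ∀ i ∈ t, ∀ j ∈ t, i < j → W i j ∉ b m :=
    (Filter.eventually_all_finset t).2 fun i hi => (Filter.eventually_all_finset t).2 fun j hj => by
      by_cases h : i < j
      · filter_upwards [eventually_notMem_of_notMem_bind (hc ▸ ht.notMem_c i hi j hj h)] with m hm _
          using hm
      · exact Filter.Eventually.of_forall fun m h' => absurd h' h
  have e7 : ∀ᶠ m in (q : Filter ℕ), ∀ i ∈ t, ∀ j ∈ t, ∀ k ∈ t, i < j → k ≠ j →
      (k ≠ i ∨ ¬ K i) → W i j ∉ F k m :=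
    (Filter.eventually_all_finset t).2 fun i hi => (Filter.eventually_all_finset t).2 fun j hj =>
      (Filter.eventually_all_finset t).2 fun k hk => by
      by_cases h : i < j ∧ k ≠ j ∧ (k ≠ i ∨ ¬ K i)
      · have := ht.notMem_b i hi j hj k hk h.1 h.2.1 h.2.2
        filter_upwards [eventually_notMem_of_notMem_bind (hb k ▸ this)] with m hm _ _ _ using hm
      · exact Filter.Eventually.of_forall fun m h1 h2 h3 => absurd ⟨h1, h2, h3⟩ h
  filter_upwards [e0, hne, e2, e3, e4, e5, e6, e7] with m e0 e1 e2 e3 e4 e5 e6 e7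
  have hmem : ∀ {i}, i ∈ insert m t → i = m ∨ i ∈ t := Finset.mem_insert.1
  have hlt : ∀ {i j}, i ∈ insert m t → j ∈ insert m t → i < j → i ∈ t := fun {i j} hi hj hij => by
    rcases hmem hi with rfl | hi
    · rcases hmem hj with rfl | hj
      · exact absurd hij (lt_irrefl _)
      · exact absurd hij (e0 j hj).not_gt
    · exact hi
  refine ⟨fun i hi => ?_, fun i hi j hj hij => ?_, fun i hi j hj hij => ?_, fun i hi j hj hij => ?_,
    fun i hi j hj k hk hij hkj hor => ?_, fun i hi j hj k hk l hl hij hjl hkl hkj hor => ?_⟩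
  · rcases hmem hi with rfl | hi
    exacts [e1, ht.ne i hi]
  · have hi' := hlt hi hj hij
    rcases hmem hj with rfl | hj
    exacts [e3 i hi', ht.row i hi' j hj hij]
  · have hi' := hlt hi hj hij
    rcases hmem hj with rfl | hj
    exacts [e4 i hi', ht.lim i hi' j hj hij]
  · have hi' := hlt hi hj hij
    rcases hmem hj with rfl | hj
    exacts [hWc _ _ (e2 i hi'), ht.notMem_c i hi' j hj hij]
  · have hi' := hlt hi hj hij
    rcases hmem hj with rfl | hj'
    · have hk' := (hmem hk).resolve_left hkj
      exact hWb _ _ _ (e0 k hk').le (e5 i hi' k hk' hor)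
    · rcases hmem hk with rfl | hk
      exacts [e6 i hi' j hj' hij, ht.notMem_b i hi' j hj' k hk hij hkj hor]
  · have hi' := hlt hi hj hij
    have hj' := hlt hj hl hjl
    have hk' := hlt hk hl hkl
    rcases hmem hl with rfl | hl
    exacts [e7 i hi' j hj' k hk' hij hkj hor, ht.notMem i hi' j hj' k hk' l hl hij hjl hkl hkj hor]

/-- Every double sequence in `βω` is constant or separated on the pairs from an infinite set. -/
theorem exists_infinite_const_or_separatedOn (F : ℕ → ℕ → Ultrafilter ℕ) :
    ∃ H : Set ℕ, H.Infinite ∧ ((∃ z, ∀ i ∈ H, ∀ j ∈ H, i < j → F i j = z) ∨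
      ∃ W, SeparatedOn F H W) := by
  classical
  let q : Ultrafilter ℕ := Filter.hyperfilter ℕ
  have hq : IsFree q := fun s hs => Filter.mem_hyperfilter_of_finite_compl hs
  let b : ℕ → Ultrafilter ℕ := fun n => q.bind (F n)
  let c : Ultrafilter ℕ := q.bind b
  by_cases hcase : ∀ᶠ n in (q : Filter ℕ), ∀ᶠ m in (q : Filter ℕ), F n m = c
  · obtain ⟨H, hH, h⟩ := exists_infinite_forall_lt hq hcase
    exact ⟨H, hH, Or.inl ⟨c, h⟩⟩
  · have hne : ∀ᶠ n in (q : Filter ℕ), ∀ᶠ m in (q : Filter ℕ), F n m ≠ c := by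
      filter_upwards [Ultrafilter.eventually_not.2 hcase] with n hn
        using Ultrafilter.eventually_not.2 hn
    have hW : ∀ i j, ∃ W ∈ F i j, (F i j ≠ c → W ∉ c) ∧ ∀ k ≤ j, F i j ≠ b k → W ∉ b k := by
      intro i j
      obtain ⟨W, hW, h⟩ := exists_mem_forall_notMem (Finset.insertNone (Finset.range (j + 1)))
        (F i j) fun k => k.elim c b
      -- `none` stands for `c` and `some k` for `b k`. Only `k ≤ j` is needed: the later `b m` avoid
      -- `W i j` because `c` does.
      exact ⟨W, hW, h none (by simp), fun k hk => h (some k) (by simpa using Nat.lt_succ_of_le hk)⟩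
    choose W hW hWc hWb using hW
    let K : ℕ → Prop := fun n => ∀ᶠ m in (q : Filter ℕ), F n m = b n
    obtain ⟨H, hH, h⟩ := exists_infinite_forall_finset hq (Approx q F b c W K)
      ⟨by simp, by simp, by simp, by simp, by simp, by simp⟩
      fun t ht => ht.eventually_insert hq (fun _ => rfl) rfl hne (fun _ => Iff.rfl) hWc hWb
    -- Removing the earlier sets not in `F k l` turns the non-membership in `Approx.notMem` into
    -- disjointness.
    let V : ℕ → ℕ → Set ℕ := fun k l =>
      W k l ∩ ⋂ a ∈ Finset.range l ×ˢ Finset.range l, if W a.1 a.2 ∈ F k l then Set.univ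
        else (W a.1 a.2)ᶜ
    have hV : ∀ k l, V k l ∈ F k l := fun k l => by
      refine Filter.inter_mem (hW k l) ((Filter.biInter_finset_mem _).2 fun a _ => ?_)
      split_ifs with ha
      exacts [Filter.univ_mem, Ultrafilter.compl_mem_iff_notMem.2 ha]
    have hdisj : ∀ i ∈ H, ∀ j ∈ H, ∀ k ∈ H, ∀ l ∈ H, i < j → j < l → k < l → k ≠ j →
        (k ≠ i ∨ ¬ K i) → Disjoint (V i j) (V k l) := by
      intro i hi j hj k hk l hl hij hjl hkl hkj hor
      have hn := (h {i, j, k, l} (by simp [Set.insert_subset_iff, hi, hj, hk, hl])).notMem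
        i (by simp) j (by simp) k (by simp) l (by simp) hij hjl hkl hkj hor
      refine Set.disjoint_left.2 fun x hx hx' => ?_
      have := Set.mem_iInter₂.1 hx'.2 (i, j) (by simp; omega)
      rw [if_neg hn] at this
      exact this hx.1
    refine ⟨H, hH, Or.inr ⟨V, fun i _ j _ _ => hV i j, ?_, fun n hn => ?_⟩⟩
    · intro i hi j hj k hk l hl hij hkl hik hil hjk hjl
      rcases lt_or_gt_of_ne hjl with hlt | hlt
      · exact hdisj i hi j hj k hk l hl hij hlt hkl hjk.symm (Or.inl hik.symm)
      · exact (hdisj k hk l hl i hi j hj hkl hlt hij hil (Or.inl hik)).symm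
    · by_cases hK : K n
      · exact Or.inl ⟨b n, fun m hm hnm => (h {n, m} (by simp [Set.insert_subset_iff, hn, hm])).row
          n (by simp) m (by simp) hnm hK⟩
      · refine Or.inr fun j hj l hl hnj hnl hjl => ?_
        rcases lt_or_gt_of_ne hjl with hlt | hlt
        · exact hdisj n hn j hj n hn l hl hnj hlt hnl hnj.ne (Or.inr hK)
        · exact (hdisj n hn l hl n hn j hj hnl hlt hnj hnl.ne (Or.inr hK)).symm

theorem bind_eq_of_eventually_eq {p z : Ultrafilter ℕ} {s : ℕ → Ultrafilter ℕ}
    (h : ∀ᶠ n in (p : Filter ℕ), s n = z) : p.bind s = z := by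
  refine (Ultrafilter.eq_of_le fun U hU => ?_)
  change ∀ᶠ n in (p : Filter ℕ), U ∈ s n
  filter_upwards [h] with n hn
  exact hn ▸ hU

/-- For every double sequence in `βω` there is an infinite set `H` such that every point outside
the range of the sequence is a row limit or a double limit for at most one free `p` containing
`H`. -/
theorem exists_infinite_limits_injective (F : ℕ → ℕ → Ultrafilter ℕ) :
    ∃ H : Set ℕ, H.Infinite ∧ ∀ p p' : Ultrafilter ℕ, IsFree p → IsFree p' → H ∈ p → H ∈ p' →
      (∀ n ∈ H, (∀ i j, i < j → F i j ≠ p.bind (F n)) → p.bind (F n) = p'.bind (F n) → p = p') ∧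
      ((∀ i j, i < j → F i j ≠ p.bind fun n => p.bind (F n)) →
        ((p.bind fun n => p.bind (F n)) = p'.bind fun n => p'.bind (F n)) → p = p') := by
  obtain ⟨H, hH, ⟨z, hz⟩ | ⟨W, hW⟩⟩ := exists_infinite_const_or_separatedOn F
  · refine ⟨H, hH, fun p p' hp hp' hpH hpH' => ?_⟩
    have hrow : ∀ n ∈ H, p.bind (F n) = z := fun n hn => bind_eq_of_eventually_eq (by
      filter_upwards [hpH, hp.eventually_gt n] with m hm hnm using hz n hn m hm hnm)
    have hlim : (p.bind fun n => p.bind (F n)) = z := bind_eq_of_eventually_eq (by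
      filter_upwards [hpH] with n hn using hrow n hn)
    -- In the constant case every limit lies in the range, so both claims are vacuous.
    obtain ⟨i, hi⟩ := hH.nonempty
    obtain ⟨j, hj, hij⟩ := hH.exists_gt i
    exact ⟨fun n hn h => absurd (hz i hi j hj hij) (hrow n hn ▸ h i j hij),
      fun h => absurd (hz i hi j hj hij) (hlim ▸ h i j hij)⟩
  · refine ⟨H, hH, fun p p' hp hp' hpH hpH' => ⟨fun n hn hz h => ?_, fun _ h =>
      eq_of_bind_bind_eq hp hp' hpH hpH' hW.mem hW.disj h⟩⟩
    rcases hW.row n hn with ⟨z, hz'⟩ | hrow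
    · obtain ⟨j, hj, hnj⟩ := hH.exists_gt n
      refine absurd ((hz' j hj hnj).trans (bind_eq_of_eventually_eq ?_).symm) (hz n j hnj)
      filter_upwards [hpH, hp.eventually_gt n] with m hm hnm using hz' m hm hnm
    · refine eq_of_bind_eq (H := H ∩ Set.Ioi n) (W := W n) ?_ ?_ ?_ ?_ h
      · exact Filter.inter_mem hpH (hp.eventually_gt n)
      · exact Filter.inter_mem hpH' (hp'.eventually_gt n)
      · exact fun i hi => hW.mem n hn i hi.1 hi.2
      · exact fun i hi j hj hij => hrow i hi.1 j hj.1 hi.2 hj.2 hij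

/-! ### Limits avoiding continuum many points -/

/-- The `n`-th row of a double sequence, extended by a principal ultrafilter. -/
noncomputable def row {α : Type*} [Inhabited α] (f : Pairs → Ultrafilter α) (n m : ℕ) :
    Ultrafilter α :=
  if h : n < m then f ⟨(n, m), h⟩ else pure default

theorem row_of_lt {α : Type*} [Inhabited α] (f : Pairs → Ultrafilter α) {n m : ℕ} (h : n < m) :
    row f n m = f ⟨(n, m), h⟩ :=
  dif_pos h

/-- The sequence `v` consists of a double limit `v 0` of `f` and of row limits `v (n + 1)` of `f`,
for some free ultrafilter, and all its terms outside the range of `f` avoid `B`. -/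
def IsLimitSeq (f : Pairs → Ultrafilter ℕ) (B : Set (Ultrafilter ℕ)) (v : ℕ → Ultrafilter ℕ) :
    Prop :=
  (∃ p, IsFree p ∧ ∃ A ∈ p, (∀ n ∈ A, p.bind (row f n) = v (n + 1)) ∧
    p.bind (fun n => v (n + 1)) = v 0) ∧ ∀ k, v k ∈ Set.range f ∨ v k ∉ B

theorem bind_congr_of_eventually_eq {p : Ultrafilter ℕ} {s s' : ℕ → Ultrafilter ℕ}
    (h : ∀ᶠ n in (p : Filter ℕ), s n = s' n) : p.bind s = p.bind s' := by
  refine (Ultrafilter.eq_of_le fun U hU => ?_)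
  change ∀ᶠ n in (p : Filter ℕ), U ∈ s n
  filter_upwards [h, mem_bind_iff_eventually.1 hU] with n hn hU
  exact hn ▸ hU

theorem exists_strictMono_forall_mem {H : Set ℕ} (hH : H.Infinite) :
    ∃ e : ℕ → ℕ, StrictMono e ∧ ∀ n, e n ∈ H :=
  ⟨Nat.nth (· ∈ H), Nat.nth_strictMono hH, Nat.nth_mem_of_infinite hH⟩

open Cardinal in
/-- Double limits can be found outside a given set of at most continuum many points, except for
values in the range of the double sequence. -/
theorem exists_isLimitSeq (f : Pairs → Ultrafilter ℕ) {B : Set (Ultrafilter ℕ)} (hB : #B ≤ 𝔠) :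
    ∃ v, IsLimitSeq f B v := by
  classical
  obtain ⟨H, hH, hinj⟩ := exists_infinite_limits_injective (row f)
  have hrange : ∀ z, z ∉ Set.range f → ∀ i j, i < j → row f i j ≠ z := fun z hz i j hij h =>
    hz ⟨⟨(i, j), hij⟩, (row_of_lt f hij).symm.trans h⟩
  let lim : Ultrafilter ℕ → Option ℕ → Ultrafilter ℕ := fun p o =>
    o.elim (p.bind fun n => p.bind (row f n)) fun n => p.bind (row f n)
  obtain ⟨p, hp, hpH, hgood⟩ : ∃ p, IsFree p ∧ H ∈ p ∧ ∀ o : Option ℕ, (∀ n ∈ o, n ∈ H) →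
      lim p o ∈ Set.range f ∨ lim p o ∉ B := by
    by_contra! hbad
    obtain ⟨e, he, heH⟩ := exists_strictMono_forall_mem hH
    have hmap : Function.Injective (Ultrafilter.map e) := fun v w h =>
      Ultrafilter.coe_injective (Filter.map_injective he.injective
        (congrArg Ultrafilter.toFilter h))
    have hmemH : ∀ u : Ultrafilter ℕ, H ∈ u.map e := fun u =>
      Ultrafilter.mem_map.2 (Filter.mem_of_superset Filter.univ_mem fun n _ => heH n)
    -- Ultrafilters containing `H` are reached as images under `e`. A nonprincipal one is coded by
    -- its bad limit and the kind of limit (`none`: double, `some n`: row `n`).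
    have hcode : ∀ u : Ultrafilter ℕ, ∃ s : ℕ ⊕ (B × Option ℕ),
        (∀ n, s = Sum.inl n → u.map e = pure n) ∧
        ∀ a, s = Sum.inr a → IsFree (u.map e) ∧ (∀ n ∈ a.2, n ∈ H) ∧
          lim (u.map e) a.2 ∉ Set.range f ∧ lim (u.map e) a.2 = a.1 := by
      intro u
      rcases (u.map e).le_cofinite_or_eq_pure with h | ⟨n, hn⟩
      · have hfree : IsFree (u.map e) := fun s hs => h (Filter.mem_cofinite.2 hs)
        obtain ⟨o, ho, hr, hmem⟩ := hbad _ hfree (hmemH u)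
        exact ⟨Sum.inr (⟨_, hmem⟩, o), by simp, by rintro _ ⟨⟩; exact ⟨hfree, ho, hr, rfl⟩⟩
      · exact ⟨Sum.inl n, by rintro _ ⟨⟩; exact hn, by simp⟩
    choose g hg1 hg2 using hcode
    have hg : Function.Injective g := by
      intro u u' h
      refine hmap ?_
      rcases hgu : g u with n | ⟨z, o⟩
      · rw [hg1 u n hgu, hg1 u' n (h ▸ hgu)]
      · obtain ⟨h1, ho, h2, h3⟩ := hg2 u _ hgu
        obtain ⟨h1', -, -, h3'⟩ := hg2 u' _ (h ▸ hgu)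
        have heq := h3.trans h3'.symm
        obtain ⟨hrow, hdouble⟩ := hinj _ _ h1 h1' (hmemH u) (hmemH u')
        cases o with
        | none => exact hdouble (hrange _ h2) heq
        | some n => exact hrow n (ho n rfl) (hrange _ h2) heq
    have hle : #(Ultrafilter ℕ) ≤ 𝔠 := calc
      #(Ultrafilter ℕ) ≤ #(ℕ ⊕ (B × Option ℕ)) := mk_le_of_injective hg
      _ = ℵ₀ + #B * ℵ₀ := by simp
      _ ≤ ℵ₀ + 𝔠 * ℵ₀ := by gcongr
      _ = 𝔠 := by simp
    exact hle.not_gt continuum_lt_mk_ultrafilter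
  -- Rows outside `H` get a filler value from the range of `f`, where nothing has to be avoided.
  let v : ℕ → Ultrafilter ℕ := fun k => match k with
    | 0 => lim p none
    | n + 1 => if n ∈ H then lim p (some n) else f ⟨(0, 1), zero_lt_one⟩
  refine ⟨v, ⟨p, hp, H, hpH, fun n hn => (if_pos hn).symm, ?_⟩, ?_⟩
  · refine bind_congr_of_eventually_eq ?_
    filter_upwards [hpH] with n hn using if_pos hn
  · rintro (_ | n)
    · exact hgood none (by simp)
    · by_cases hn : n ∈ H
      · simp only [v, if_pos hn]
        exact hgood (some n) (by simpa using hn)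
      · simp only [v, if_neg hn]
        exact Or.inl ⟨_, rfl⟩

/-! ### Recursion over well-founded trees -/

/-- Simultaneous choice along a well-founded relation. -/
theorem WellFounded.exists_forall_of_forall_exists {T V : Type*} [Inhabited V] {r : T → T → Prop}
    (hr : WellFounded r) (P : T → (T → V) → V → Prop)
    (hloc : ∀ t w w' v, (∀ s, r s t → w s = w' s) → P t w v → P t w' v)
    (hex : ∀ t w, ∃ v, P t w v) : ∃ w : T → V, ∀ t, P t w (w t) := by
  classical
  choose v hv using hex
  let w : T → V := hr.fix fun t prev => v t fun s => if h : r s t then prev s h else default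
  refine ⟨w, fun t => ?_⟩
  have hw : w t = v t fun s => if r s t then w s else default :=
    hr.fix_eq _ t
  rw [hw]
  refine hloc t _ _ _ (fun s hs => ?_) (hv t _)
  exact if_pos hs

/-- Well-founded trees that are leaves or branch over `[ω]²`, with nodes labelled by functions
`[ω]² → ω`. -/
inductive LimitTree : Type
  | leaf : LimitTree
  | node : (Pairs → ℕ) → (Pairs → LimitTree) → LimitTree

namespace LimitTree

/-- The ordinal rank of a tree. -/
noncomputable def rank : LimitTree → Ordinal.{0}
  | leaf => 0
  | node _ g => ⨆ x, Order.succ (rank (g x))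

/-- A tree as an element of a W-type. -/
def toWType : LimitTree → WType fun a : Option (Pairs → ℕ) => a.elim Empty fun _ => Pairs
  | leaf => WType.mk none Empty.elim
  | node σ g => WType.mk (some σ) fun x : Pairs => (g x).toWType

theorem toWType_injective : Function.Injective toWType := by
  intro s
  induction s with
  | leaf =>
    rintro (_ | ⟨σ, g⟩) h
    · rfl
    · exact absurd (WType.mk.inj h).1 (by simp)
  | node σ g ih =>
    rintro (_ | ⟨σ', g'⟩) h
    · exact absurd (WType.mk.inj h).1 (by simp)
    · obtain ⟨h1, h2⟩ := WType.mk.inj h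
      obtain rfl := Option.some.inj h1
      exact congrArg (node σ) (funext fun x => ih x (congrFun (eq_of_heq h2) x))

-- There are at most continuum many kinds of node, each with countably many branches, and `𝔠 ^ ℵ₀ =
-- 𝔠`.
open Cardinal in
theorem mk_le : #LimitTree ≤ 𝔠 := by
  refine (mk_le_of_injective toWType_injective).trans (WType.cardinalMk_le_of_le ?_)
  have h : ∀ a : Option (Pairs → ℕ), 𝔠 ^ #(a.elim Empty fun _ => Pairs) ≤ 𝔠 := fun a => by
    refine (power_le_power_left continuum_ne_zero ?_).trans continuum_power_aleph0.le
    cases a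
    · simp
    · exact mk_le_aleph0 (α := Pairs)
  refine (sum_le_sum _ _ h).trans ?_
  have hα : #(Option (Pairs → ℕ)) ≤ 𝔠 := by
    have h2 : ℵ₀ ^ #Pairs ≤ 𝔠 :=
      (power_le_power_left aleph0_ne_zero (mk_le_aleph0 (α := Pairs))).trans
        aleph0_power_aleph0.le
    rw [mk_option, mk_arrow]
    simpa using (add_le_add h2 one_le_aleph0).trans continuum_add_aleph0.le
  simpa using (mul_le_mul' hα le_rfl).trans continuum_mul_self.le

/-- A well-order of `ω × LimitTree` in which subtrees come first. -/
theorem exists_wellOrder : ∃ r : ℕ × LimitTree → ℕ × LimitTree → Prop, WellFounded r ∧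
    (∀ s t, s ≠ t → r s t ∨ r t s) ∧ ∀ n σ g x, r (n, g x) (n, node σ g) := by
  let emb : ℕ × LimitTree → Ordinal.{0} × (ℕ × LimitTree) := fun t => (t.2.rank, t)
  refine ⟨InvImage (Prod.Lex (· < ·) WellOrderingRel) emb,
    InvImage.wf _ (WellFounded.prod_lex Ordinal.lt_wf WellOrderingRel.isWellOrder.wf), ?_, ?_⟩
  · intro s t hst
    rcases lt_trichotomy s.2.rank t.2.rank with h | h | h
    · exact Or.inl (Prod.Lex.left _ _ h)
    · rcases trichotomous_of WellOrderingRel s t with h' | h' | h'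
      · left; simp only [InvImage, emb, h]; exact Prod.Lex.right _ h'
      · exact absurd h' hst
      · right; simp only [InvImage, emb, h]; exact Prod.Lex.right _ h'
    · exact Or.inr (Prod.Lex.left _ _ h)
  · intro n σ g x
    refine Prod.Lex.left _ _ ?_
    change rank (g x) < ⨆ y, Order.succ (rank (g y))
    exact (Order.lt_succ _).trans_le (Ordinal.le_iSup (fun y => Order.succ (rank (g y))) x)

end LimitTree

open Cardinal in
/-- There are countably many sets, each containing double limits of all double sequences in it,
that pairwise meet in `ω`. -/
theorem exists_isLimitSeq_closed_family : ∃ A : ℕ → Set (Ultrafilter ℕ),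
    (∀ n m, n ≠ m → A n ∩ A m = Set.range (pure : ℕ → Ultrafilter ℕ)) ∧
    ∀ n, ∀ f : Pairs → A n, ∃ v, IsLimitSeq (fun x => (f x : Ultrafilter ℕ)) ∅ v ∧
      ∀ k, v k ∈ A n := by
  obtain ⟨r, hwf, htri, hr⟩ := LimitTree.exists_wellOrder
  -- A leaf carries the principal ultrafilters. At a node the `x`-th value of the double sequence is
  -- term `σ x` of the sequence of subtree `x`. Subtrees keep the index `n`, but earlier points of
  -- all indices are avoided.
  let P : ℕ × LimitTree → (ℕ × LimitTree → ℕ → Ultrafilter ℕ) → (ℕ → Ultrafilter ℕ) → Prop :=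
    fun t w v => (∀ n, t = (n, LimitTree.leaf) → v = pure) ∧
      ∀ n σ g, t = (n, LimitTree.node σ g) →
        IsLimitSeq (fun x => w (n, g x) (σ x)) {z | ∃ s k, r s t ∧ w s k = z} v
  obtain ⟨w, hw⟩ : ∃ w : ℕ × LimitTree → ℕ → Ultrafilter ℕ, ∀ t, P t w (w t) := by
    have : Inhabited (ℕ → Ultrafilter ℕ) := ⟨pure⟩
    refine hwf.exists_forall_of_forall_exists P ?_ ?_
    · rintro t w w' v h ⟨h1, h2⟩
      refine ⟨h1, fun n σ g ht => ?_⟩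
      have hf : (fun x => w (n, g x) (σ x)) = fun x => w' (n, g x) (σ x) :=
        funext fun x => by rw [h _ (ht ▸ hr n σ g x)]
      have hB : {z | ∃ s k, r s t ∧ w s k = z} = {z | ∃ s k, r s t ∧ w' s k = z} :=
        Set.ext fun z => exists₂_congr fun s k => and_congr_right fun hs => by rw [h s hs]
      rw [← hf, ← hB]
      exact h2 n σ g ht
    · rintro ⟨n, _ | ⟨σ, g⟩⟩ w
      · refine ⟨pure, fun _ _ => rfl, fun m σ g' h => ?_⟩
        simp at h
      · have hcard : #{z | ∃ s k, r s (n, LimitTree.node σ g) ∧ w s k = z} ≤ 𝔠 := calc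
          _ ≤ #(Set.range fun a : (ℕ × LimitTree) × ℕ => w a.1 a.2) :=
            mk_le_mk_of_subset (by rintro _ ⟨s, k, -, rfl⟩; exact ⟨(s, k), rfl⟩)
          _ ≤ #((ℕ × LimitTree) × ℕ) := mk_range_le
          _ = ℵ₀ * #LimitTree * ℵ₀ := by simp
          _ ≤ ℵ₀ * 𝔠 * ℵ₀ := by gcongr; exact LimitTree.mk_le
          _ = 𝔠 := by simp
        obtain ⟨v, hv⟩ := exists_isLimitSeq (fun x => w (n, g x) (σ x)) hcard
        refine ⟨v, fun m h => by simp at h, fun m σ' g' h => ?_⟩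
        cases h
        exact hv
  have hpure : ∀ n k, ∃ t, w (n, t) k = pure k := fun n k =>
    ⟨LimitTree.leaf, by rw [(hw _).1 n rfl]⟩
  refine ⟨fun n => {z | ∃ t k, w (n, t) k = z}, fun n m hnm => ?_, fun n f => ?_⟩
  · refine Set.Subset.antisymm ?_ ?_
    · rintro z ⟨⟨t, k, hz⟩, t', k', hz'⟩
      by_contra hprin
      -- The first occurrence of `z` with index `i` is the first with any index: it is not at a
      -- leaf, and not in the range of the node's double sequence, since a subtree would come
      -- earlier. So it is a term that avoids all earlier points.
      have hfirst : ∀ i, (∃ t k, w (i, t) k = z) → ∃ t, (∃ k, w (i, t) k = z) ∧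
          ∀ s k, w s k = z → ¬ r s (i, t) := by
        rintro i ⟨t, k, hz⟩
        obtain ⟨⟨i', t⟩, ⟨rfl, k, hk⟩, hmin⟩ := hwf.has_min
          {s : ℕ × LimitTree | s.1 = i ∧ ∃ k, w s k = z} ⟨(i, t), rfl, k, hz⟩
        refine ⟨t, ⟨k, hk⟩, fun s l hl hs => ?_⟩
        rcases t with _ | ⟨σ, g⟩
        · exact hprin ⟨k, by rw [← hk, (hw _).1 _ rfl]⟩
        · rcases ((hw _).2 _ σ g rfl).2 k with ⟨x, hx⟩ | hB
          · exact hmin (i', g x) ⟨rfl, σ x, hx.trans hk⟩ (hr i' σ g x)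
          · exact hB ⟨s, l, hs, hl.trans hk.symm⟩
      obtain ⟨t₁, ⟨k₁, h₁⟩, hmin₁⟩ := hfirst n ⟨t, k, hz⟩
      obtain ⟨t₂, ⟨k₂, h₂⟩, hmin₂⟩ := hfirst m ⟨t', k', hz'⟩
      rcases htri (n, t₁) (m, t₂) (fun h => hnm (congrArg Prod.fst h)) with h | h
      exacts [hmin₂ _ k₁ h₁ h, hmin₁ _ k₂ h₂ h]
    · rintro _ ⟨k, rfl⟩
      obtain ⟨t, ht⟩ := hpure n k
      obtain ⟨t', ht'⟩ := hpure m k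
      exact ⟨⟨t, k, ht⟩, t', k, ht'⟩
  · choose g σ h using fun x => (f x).2
    refine ⟨w (n, LimitTree.node σ g), ?_, fun k => ⟨_, k, rfl⟩⟩
    have := (hw (n, LimitTree.node σ g)).2 n σ g rfl
    simp only [h] at this
    exact ⟨this.1, fun k => Or.inr (by simp)⟩

/-! ### The column space -/

theorem exists_mem_subset_of_isOpen {α : Type*} {S : Set (Ultrafilter α)} {U : Set S}
    (hU : IsOpen U) {x : S} (hx : x ∈ U) :
    ∃ V ∈ (x : Ultrafilter α), ∀ y : S, V ∈ (y : Ultrafilter α) → y ∈ U := by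
  obtain ⟨O, hO, rfl⟩ := isOpen_induced_iff.1 hU
  obtain ⟨_, ⟨V, rfl⟩, hxV, hV⟩ :=
    ultrafilterBasis_is_basis.exists_subset_of_mem_open (a := (x : Ultrafilter α)) hx hO
  exact ⟨V, hxV, fun y hy => hV hy⟩

theorem isOpen_setOf_mem {α : Type*} (S : Set (Ultrafilter α)) (V : Set α) :
    IsOpen {x : S | V ∈ (x : Ultrafilter α)} :=
  (ultrafilter_isOpen_basic V).preimage continuous_subtype_val

/-- In a space of ultrafilters, `p`-limits are given by `Ultrafilter.bind`. -/
theorem isPLimit_of_bind_eq {α : Type*} {S : Set (Ultrafilter α)} {p : Ultrafilter ℕ} {D : Set ℕ}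
    (hD : D ∈ p) {s : D → S} {G : ℕ → Ultrafilter α} (hG : ∀ n : D, G n = s n) {x : S}
    (hx : p.bind G = x) : IsPLimit p D s x := by
  intro U hU hxU
  obtain ⟨V, hV, hVU⟩ := exists_mem_subset_of_isOpen hU hxU
  rw [← hx] at hV
  filter_upwards [hD, mem_bind_iff_eventually.1 hV] with n hn hnV
  exact ⟨hn, hVU _ (hG ⟨n, hn⟩ ▸ hnV)⟩

theorem doublyCountablyCompact_of_isLimitSeq {A : Set (Ultrafilter ℕ)}
    (hA : ∀ f : Pairs → A, ∃ v, IsLimitSeq (fun x => (f x : Ultrafilter ℕ)) ∅ v ∧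
      ∀ k, v k ∈ A) : DoublyCountablyCompact A := by
  intro f
  obtain ⟨v, ⟨⟨p, hp, D, hD, hrow, hlim⟩, -⟩, hv⟩ := hA f
  refine ⟨p, hp, ⟨v 0, hv 0⟩, D, hD, fun n => ⟨v (n + 1), hv _⟩, fun n => ?_, ?_⟩
  · exact isPLimit_of_bind_eq (hp.eventually_gt n) (fun m => row_of_lt _ m.2) (hrow n n.2)
  · exact isPLimit_of_bind_eq hD (fun _ => rfl) hlim

/-- This recovers a point of `A k` from a point over column `k`: distinct columns are disjoint, and
the remaining ultrafilters contain no column. -/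
theorem exists_map_eq_of_column_mem {A : ℕ → Set (Ultrafilter ℕ)} {z : Ultrafilter (ℕ × ℕ)}
    (hz : z ∈ columnSpace A) {k : ℕ} (hk : column k ∈ z) :
    ∃ a ∈ A k, a.map (Prod.mk k) = z := by
  rcases hz with hz | hz
  · obtain ⟨j, a, ha, rfl⟩ := Set.mem_iUnion.1 hz
    obtain ⟨m, hm, -⟩ := Ultrafilter.nonempty_of_mem (Ultrafilter.mem_map.1 hk)
    obtain rfl : j = k := hm
    exact ⟨a, ha, rfl⟩
  · exact absurd hk (hz k)

theorem map_mem_columnSpace {A : ℕ → Set (Ultrafilter ℕ)} {k : ℕ} {a : Ultrafilter ℕ}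
    (ha : a ∈ A k) : a.map (Prod.mk k) ∈ columnSpace A :=
  Or.inl (Set.mem_iUnion.2 ⟨k, a, ha, rfl⟩)

theorem MemSq.mono {p : Ultrafilter ℕ} {A B : Set Pairs} (h : MemSq p A) (hAB : A ⊆ B) :
    MemSq p B :=
  Filter.mem_of_superset h fun _ hn => Filter.mem_of_superset hn fun _ ⟨h, hm⟩ => ⟨h, hAB hm⟩

theorem IsFree.map {p : Ultrafilter ℕ} (hp : IsFree p) {e : ℕ → ℕ} (he : Function.Injective e) :
    IsFree (p.map e) := fun s hs =>
  hp (e ⁻¹' s) (hs.preimage he.injOn)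

/-- The square of the image of `p` under an increasing map. -/
theorem memSq_map_of_memSq {p : Ultrafilter ℕ} {e : ℕ → ℕ} (he : StrictMono e) {S : Set Pairs}
    (h : MemSq p {x | (⟨(e x.1.1, e x.1.2), he x.2⟩ : Pairs) ∈ S}) : MemSq (p.map e) S := by
  refine Ultrafilter.mem_map.2 (Filter.mem_of_superset h fun n hn => ?_)
  exact Ultrafilter.mem_map.2 (Filter.mem_of_superset hn fun m ⟨hnm, hm⟩ => ⟨he hnm, hm⟩)

/-- A double limit is a limit along the square of the ultrafilter. -/
theorem IsDoubleLimit.isSqLimit {X : Type*} [TopologicalSpace X] {p : Ultrafilter ℕ}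
    {f : Pairs → X} {x : X} (h : IsDoubleLimit p f x) : IsSqLimit p f x := by
  intro U hU hx
  obtain ⟨A, -, y, hy, hyx⟩ := h
  filter_upwards [hyx U hU hx] with n ⟨hn, hnU⟩
  filter_upwards [hy ⟨n, hn⟩ U hU hnU] with m ⟨hm, hmU⟩ using ⟨hm, hmU⟩

theorem twoCountablyCompact_columnSpace {A : ℕ → Set (Ultrafilter ℕ)}
    (hA : ∀ n, DoublyCountablyCompact (A n)) : TwoCountablyCompact (columnSpace A) := by
  intro f
  let q : Ultrafilter ℕ := Filter.hyperfilter ℕ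
  have hq : IsFree q := fun s hs => Filter.mem_hyperfilter_of_finite_compl hs
  let F := row fun x => (f x : Ultrafilter (ℕ × ℕ))
  by_cases h : ∀ k, column k ∉ q.bind fun n => q.bind (F n)
  · refine ⟨q, hq, ⟨_, Or.inr h⟩, fun U hU hxU => ?_⟩
    obtain ⟨V, hV, hVU⟩ := exists_mem_subset_of_isOpen hU hxU
    filter_upwards [mem_bind_iff_eventually.1 hV] with n hn
    filter_upwards [mem_bind_iff_eventually.1 hn, hq.eventually_gt n] with m hm hnm
    exact ⟨hnm, hVU _ (row_of_lt (fun x => (f x : Ultrafilter (ℕ × ℕ))) hnm ▸ hm)⟩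
  · push Not at h
    obtain ⟨k, hk⟩ := h
    obtain ⟨H, hH, hHk⟩ := exists_infinite_forall_lt hq (R := fun n m => column k ∈ F n m) hk
    obtain ⟨e, he, heH⟩ := exists_strictMono_forall_mem hH
    have hcol : ∀ x : Pairs, ∃ a : A k, (a : Ultrafilter ℕ).map (Prod.mk k) =
        f ⟨(e x.1.1, e x.1.2), he x.2⟩ := fun x => by
      have hx := hHk _ (heH x.1.1) _ (heH x.1.2) (he x.2)
      rw [show F _ _ = _ from row_of_lt _ (he x.2)] at hx
      obtain ⟨a, ha, h⟩ := exists_map_eq_of_column_mem (f _).2 hx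
      exact ⟨⟨a, ha⟩, h⟩
    choose g hg using hcol
    obtain ⟨p, hp, x, hx⟩ := hA k g
    -- The limit found for the subsequence along `e` is transported to the original double sequence
    -- by pushing `p` forward.
    refine ⟨p.map e, hp.map he.injective, ⟨_, map_mem_columnSpace x.2⟩, fun U hU hxU => ?_⟩
    obtain ⟨V, hV, hVU⟩ := exists_mem_subset_of_isOpen hU hxU
    refine memSq_map_of_memSq he ((hx.isSqLimit _ (isOpen_setOf_mem _ (Prod.mk k ⁻¹' V))
      (Ultrafilter.mem_map.1 hV)).mono fun y hy => hVU _ ?_)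
    rw [← hg y]
    exact Ultrafilter.mem_map.2 hy

theorem not_doublyCountablyCompact_columnSpace {A : ℕ → Set (Ultrafilter ℕ)}
    (hA : ∀ n m, n ≠ m → A n ∩ A m = Set.range (pure : ℕ → Ultrafilter ℕ)) :
    ¬ DoublyCountablyCompact (columnSpace A) := by
  intro h
  have hpure : ∀ n m : ℕ, (pure m : Ultrafilter ℕ) ∈ A n := fun n m =>
    ((hA n (n + 1) (by omega)).ge ⟨m, rfl⟩).1
  -- The test sequence sends `(n, m)` to the principal ultrafilter at `(n, m)`; its row limits are
  -- copies of `p` in the columns.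
  obtain ⟨p, hp, x, D, hD, y, hy, -⟩ :=
    h fun a => ⟨_, map_mem_columnSpace (hpure a.1.1 a.1.2)⟩
  have hyn : ∀ n : D, (y n : Ultrafilter (ℕ × ℕ)) = p.map (Prod.mk (n : ℕ)) := fun n => by
    refine (Ultrafilter.eq_of_le fun V hV => ?_).symm
    refine Ultrafilter.mem_map.2 ?_
    filter_upwards [hy n _ (isOpen_setOf_mem _ V) hV] with m ⟨hm, hmV⟩
    exact hmV
  have hpA : ∀ n ∈ D, p ∈ A n := fun n hn => by
    have hcol : column n ∈ p.map (Prod.mk n) :=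
      Ultrafilter.mem_map.2 (Filter.mem_of_superset Filter.univ_mem fun m _ => ⟨rfl, trivial⟩)
    obtain ⟨a, ha, hap⟩ := exists_map_eq_of_column_mem (hyn ⟨n, hn⟩ ▸ (y ⟨n, hn⟩).2) hcol
    have : a = p := Ultrafilter.coe_injective
      (Filter.map_injective (Prod.mk_right_injective n) (congrArg Ultrafilter.toFilter hap))
    exact this ▸ ha
  obtain ⟨n, hn⟩ := Ultrafilter.nonempty_of_mem hD
  obtain ⟨m, hm, hnm⟩ := Ultrafilter.nonempty_of_mem (Filter.inter_mem hD (hp.eventually_gt n))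
  obtain ⟨k, rfl⟩ := (hA n m (ne_of_lt hnm)).le ⟨hpA n hn, hpA m hm⟩
  obtain ⟨j, hj, hjk⟩ := Ultrafilter.nonempty_of_mem (Filter.inter_mem (hp.eventually_gt k)
    (Ultrafilter.mem_pure.2 (Set.mem_singleton k)))
  exact absurd hjk (ne_of_gt hj)

/-- The construction works in ZFC: the hypothesis on Ramsey ultrafilters is not needed, since
Ramsey-type arguments along an arbitrary free ultrafilter suffice. -/
theorem mainTheorem2 (hRamsey : ∃ r : Ultrafilter ℕ, IsRamsey r) :
    ∃ A : ℕ → Set (Ultrafilter ℕ),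
      (∀ n, DoublyCountablyCompact (A n)) ∧
      (∀ n m, n ≠ m → A n ∩ A m = Set.range (pure : ℕ → Ultrafilter ℕ)) ∧
      T35Space (columnSpace A) ∧
      TwoCountablyCompact (columnSpace A) ∧
      ¬ DoublyCountablyCompact (columnSpace A) := by
  obtain ⟨A, hA, hlim⟩ := exists_isLimitSeq_closed_family
  have hcc : ∀ n, DoublyCountablyCompact (A n) := fun n =>
    doublyCountablyCompact_of_isLimitSeq (hlim n)
  -- The Tychonoff property is inherited from the compact Hausdorff space `β(ω × ω)`.
  exact ⟨A, hcc, hA, inferInstance, twoCountablyCompact_columnSpace hcc,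
    not_doublyCountablyCompact_columnSpace hA⟩
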